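/- **Proposition (Chernoff parameter and Bhattacharyya coefficient for Cauchy laws, closed form).** For $l\in\mathbb R$ and $s>0$ let $\mathrm{Cauchy}(l,s)$ be the law on $\mathbb R$ with Lebesgue density $p_{l,s}(x)=\dfrac{s}{\pi\,(s^2+(x-l)^2)}$. Let $l_1,l_2\in\mathbb R$, $s_1,s_2>0$, $\delta:=l_1-l_2$, $\mathbb P=\mathrm{Cauchy}(l_1,s_1)$, $\mathbb Q=\mathrm{Cauchy}(l_2,s_2)$, and for $\alpha\in[0,1]$ put $$\rho_\alpha:=\int_{\mathbb R}p_{l_1,s_1}(x)^{\alpha}\,p_{l_2,s_2}(x)^{1-\alpha}\,dx,\qquad D_{B,\alpha}:=-\ln\rho_\alpha,\qquad D_C:=\sup_{\alpha\in[0,1]}D_{B,\alpha}.$$ Let $K(m):=\int_0^{\pi/2}\dfrac{du}{\sqrt{1-m\sin^2u}}$, $m\in[0,1)$, be the complete elliptic integral of the first kind. Then: 1. $\rho_\alpha\in(0,\infty)$, $\rho_\alpha=\rho_{1-\alpha}$ and $D_{B,\alpha}=D_{B,1-\alpha}$ for every $\alpha\in[0,1]$. 2. If $\mathbb P\neq\mathbb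 Q$, then $\alpha^*=\tfrac12$ is the unique maximiser of $\alpha\mapsto D_{B,\alpha}$ on $[0,1]$. If $\mathbb P=\mathbb Q$, then $D_{B,\alpha}=0$ for all $\alpha\in[0,1]$ and every $\alpha\in[0,1]$ is a maximiser. 3. In all cases the supremum is a maximum and $D_C=\max_{\alpha\in[0,1]}D_{B,\alpha}=D_{B,1/2}=-\ln\rho_{1/2}$. 4. The number $m:=\dfrac{(s_1-s_2)^2+\delta^2}{(s_1+s_2)^2+\delta^2}$ lies in $[0,1)$, and $$\rho_{1/2}=\int_{\mathbb R}\sqrt{p_{l_1,s_1}(x)\,p_{l_2,s_2}(x)}\,dx =\frac{4\sqrt{s_1s_2}}{\pi\sqrt{(s_1+s_2)^2+\delta^2}}\;K(m).$$ -/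

import Mathlib

open MeasureTheory ProbabilityTheory Set
open scoped NNReal Real

/-- The `α`-Bhattacharyya coefficient `ρ_α = ∫ p ^ α * q ^ (1 - α) dμ` of two laws with
densities `p` and `q` with respect to `μ`. -/
noncomputable def bhattacharyyaCoeff {X : Type*} [MeasurableSpace X] (μ : Measure X)
    (p q : X → ℝ) (α : ℝ) : ℝ :=
  ∫ x, p x ^ α * q x ^ (1 - α) ∂μ

/-- The `α`-Bhattacharyya distance `D_{B,α} = - ln ρ_α`. -/
noncomputable def bhattacharyyaDist {X : Type*} [MeasurableSpace X] (μ : Measure X)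
    (p q : X → ℝ) (α : ℝ) : ℝ :=
  -Real.log (bhattacharyyaCoeff μ p q α)

/-- The Chernoff information: the supremum (a maximum, whenever it is attained) of the
Bhattacharyya distances `D_{B,α}` over `α ∈ [0, 1]`. -/
noncomputable def chernoffInformation {X : Type*} [MeasurableSpace X] (μ : Measure X)
    (p q : X → ℝ) : ℝ :=
  sSup (bhattacharyyaDist μ p q '' Icc 0 1)

/-- The complete elliptic integral of the first kind, as a function of the parameter
`m ∈ [0, 1)` (the square of the modulus). -/
noncomputable def completeEllipticK (m : ℝ) : ℝ :=
  ∫ u in (0 : ℝ)..(π / 2), 1 / √(1 - m * Real.sin u ^ 2)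

/-! In the angular coordinate of a suitable midpoint law `Cauchy(c, σ)`, the two densities relative
to that law are `(a + d cos θ)⁻¹` and `(a - d cos θ)⁻¹`, up to a rotation
(`exists_cauchyPDFReal_midpoint`). A half-turn exchanges them, so `ρ_α = ρ_{1-α}`. By symmetry, `2
(ρ_α - ρ_{1/2})` is the integral of a perfect square: `1 / 2` minimises `ρ`, and for `α ≠ 1 / 2`
equality forces the densities to agree a.e. (`integral_sq_eq_bhattacharyyaCoeff_sub`,
`eq_of_rpow_mul_rpow_eq`). At `1 / 2` the integrand is `(a² - d² cos² θ)^(-1/2)`, whose integral is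
elliptic with parameter `m = d² / a²`. -/

/-! ### Cauchy laws in angular coordinates. -/

/-- Substituting `x = c + σ tan (θ / 2)` turns the Cauchy law `Cauchy(c, σ)` into the uniform law
on `(-π, π)`. -/
lemma integral_cauchyPDFReal_mul (c : ℝ) {σ : ℝ≥0} (hσ : 0 < σ) (f : ℝ → ℝ) :
    ∫ x, cauchyPDFReal c σ x * f x =
      (2 * π)⁻¹ * ∫ θ in (-π)..π, f (c + σ * Real.tan (θ / 2)) := by
  have hσ' : (0 : ℝ) < σ := hσ
  have hcos : ∀ θ ∈ Ioo (-π) π, 0 < Real.cos (θ / 2) := fun θ hθ =>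
    Real.cos_pos_of_mem_Ioo ⟨by linarith [hθ.1], by linarith [hθ.2]⟩
  have hinj : InjOn (fun θ : ℝ => c + σ * Real.tan (θ / 2)) (Ioo (-π) π) := by
    intro x hx y hy hxy
    have h : Real.tan (x / 2) = Real.tan (y / 2) :=
      mul_left_cancel₀ hσ'.ne' (add_left_cancel hxy)
    have := Real.injOn_tan ⟨by linarith [hx.1], by linarith [hx.2]⟩
      ⟨by linarith [hy.1], by linarith [hy.2]⟩ h
    linarith
  have himage : (fun θ : ℝ => c + σ * Real.tan (θ / 2)) '' Ioo (-π) π = univ := by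
    refine eq_univ_of_forall fun y => ⟨2 * Real.arctan ((y - c) / σ), ⟨?_, ?_⟩, ?_⟩
    · linarith [Real.neg_pi_div_two_lt_arctan ((y - c) / σ)]
    · linarith [Real.arctan_lt_pi_div_two ((y - c) / σ)]
    · simp only [mul_div_cancel_left₀ _ (two_ne_zero' ℝ), Real.tan_arctan]
      field_simp
      ring
  have hderiv : ∀ θ ∈ Ioo (-π) π, HasDerivWithinAt (fun θ : ℝ => c + σ * Real.tan (θ / 2))
      (σ * (1 / Real.cos (θ / 2) ^ 2 * (1 / 2))) (Ioo (-π) π) θ := fun θ hθ =>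
    (((HasDerivAt.comp (h₂ := Real.tan) θ (Real.hasDerivAt_tan (hcos θ hθ).ne')
      ((hasDerivAt_id θ).div_const 2)).const_mul (σ : ℝ)).const_add c).hasDerivWithinAt
  rw [← setIntegral_univ, ← himage,
    integral_image_eq_integral_abs_deriv_smul measurableSet_Ioo hderiv hinj,
    intervalIntegral.integral_of_le (by linarith [Real.pi_pos]), integral_Ioc_eq_integral_Ioo,
    ← integral_const_mul]
  refine setIntegral_congr_fun measurableSet_Ioo fun θ hθ => ?_
  have h := hcos θ hθ
  have hsq := Real.sin_sq_add_cos_sq (θ / 2)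
  simp only [smul_eq_mul]
  rw [abs_of_pos (by positivity), cauchyPDFReal_def, add_sub_cancel_left,
    Real.tan_eq_sin_div_cos]
  have hden : (σ * (Real.sin (θ / 2) / Real.cos (θ / 2))) ^ 2 + (σ : ℝ) ^ 2
      = σ ^ 2 / Real.cos (θ / 2) ^ 2 := by
    field_simp
    linear_combination hsq
  rw [hden]
  field_simp

/-- The ratio of two Cauchy densities, in the angular coordinate of the second one. -/
lemma cauchyPDFReal_add_mul_tan (l : ℝ) {s σ : ℝ≥0} (hs : 0 < s) (hσ : 0 < σ) (c : ℝ) {θ : ℝ}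
    (hθ : Real.cos (θ / 2) ≠ 0) :
    cauchyPDFReal l s (c + σ * Real.tan (θ / 2)) = cauchyPDFReal c σ (c + σ * Real.tan (θ / 2)) *
      (((σ * Real.sin (θ / 2) + (c - l) * Real.cos (θ / 2)) ^ 2 + (s * Real.cos (θ / 2)) ^ 2)
        / (s * σ))⁻¹ := by
  have hs' : (0 : ℝ) < s := hs
  have hσ' : (0 : ℝ) < σ := hσ
  have hsq := Real.sin_sq_add_cos_sq (θ / 2)
  have h1 : (c + σ * Real.tan (θ / 2) - c) ^ 2 + (σ : ℝ) ^ 2 = σ ^ 2 / Real.cos (θ / 2) ^ 2 := by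
    rw [Real.tan_eq_sin_div_cos]
    field_simp
    linear_combination (σ : ℝ) ^ 2 * hsq
  have h2 : (c + σ * Real.tan (θ / 2) - l) ^ 2 + (s : ℝ) ^ 2 =
      ((σ * Real.sin (θ / 2) + (c - l) * Real.cos (θ / 2)) ^ 2 + (s * Real.cos (θ / 2)) ^ 2)
        / Real.cos (θ / 2) ^ 2 := by
    rw [Real.tan_eq_sin_div_cos]
    field_simp
    ring
  have h3 : (0 : ℝ) < (σ * Real.sin (θ / 2) + (c - l) * Real.cos (θ / 2)) ^ 2
      + (s * Real.cos (θ / 2)) ^ 2 := by positivity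
  rw [cauchyPDFReal_def, cauchyPDFReal_def, h1, h2]
  field_simp

/-- Two Cauchy densities become antipodal to each other in the angular coordinate of their
hyperbolic midpoint `Cauchy(c, σ)`. -/
lemma exists_cauchyPDFReal_midpoint (l₁ l₂ : ℝ) {s₁ s₂ : ℝ≥0} (hs₁ : 0 < s₁) (hs₂ : 0 < s₂) :
    ∃ (c : ℝ) (σ : ℝ≥0) (a d φ : ℝ), 0 < σ ∧ 0 < a ∧
      a ^ 2 = (((s₁ : ℝ) + s₂) ^ 2 + (l₁ - l₂) ^ 2) / (4 * (s₁ * s₂)) ∧ a ^ 2 - d ^ 2 = 1 ∧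
      ∀ θ ∈ Ioo (-π) π,
        cauchyPDFReal l₁ s₁ (c + σ * Real.tan (θ / 2)) =
          cauchyPDFReal c σ (c + σ * Real.tan (θ / 2)) * (a + d * Real.cos (θ - φ))⁻¹ ∧
        cauchyPDFReal l₂ s₂ (c + σ * Real.tan (θ / 2)) =
          cauchyPDFReal c σ (c + σ * Real.tan (θ / 2)) * (a - d * Real.cos (θ - φ))⁻¹ := by
  have h₁ : (0 : ℝ) < s₁ := hs₁
  have h₂ : (0 : ℝ) < s₂ := hs₂
  -- With `c = l₁ - s₁ e = l₂ + s₂ e` the two `sin θ` coefficients are opposite; `σ² = s₁ s₂ (1 +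
  -- e²)` then makes the constant terms equal and the `cos θ` coefficients opposite.
  obtain ⟨e, he⟩ : ∃ e : ℝ, e = (l₁ - l₂) / (s₁ + s₂) := ⟨_, rfl⟩
  have heδ : l₁ - l₂ = e * (s₁ + s₂) := by rw [he]; field_simp
  obtain ⟨σ, hσ, hσ2⟩ : ∃ σ : ℝ≥0, 0 < σ ∧ (σ : ℝ) ^ 2 = s₁ * s₂ * (1 + e ^ 2) :=
    ⟨(√(s₁ * s₂ * (1 + e ^ 2))).toNNReal, Real.toNNReal_pos.2 (by positivity), by
      rw [Real.coe_toNNReal _ (Real.sqrt_nonneg _), Real.sq_sqrt (by positivity)]⟩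
  have hσ' : (0 : ℝ) < σ := hσ
  obtain ⟨a, ha⟩ : ∃ a : ℝ, a = (1 + e ^ 2) * (s₁ + s₂) / (2 * σ) := ⟨_, rfl⟩
  obtain ⟨b, hb⟩ : ∃ b : ℝ, b = (1 + e ^ 2) * (s₁ - s₂) / (2 * σ) := ⟨_, rfl⟩
  -- The polar form of `z` gives the amplitude and phase of `b cos θ - e sin θ`, including the case
  -- `z = 0`.
  let z : ℂ := ⟨b, -e⟩
  have hzb : ‖z‖ * Real.cos z.arg = b := Complex.norm_mul_cos_arg z
  have hze : ‖z‖ * Real.sin z.arg = -e := Complex.norm_mul_sin_arg z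
  have hz2 : ‖z‖ ^ 2 = b ^ 2 + e ^ 2 := by
    rw [← hzb, ← neg_sq e, ← hze]
    linear_combination -‖z‖ ^ 2 * Real.sin_sq_add_cos_sq z.arg
  have ha2 : a ^ 2 = (1 + e ^ 2) * (s₁ + s₂) ^ 2 / (4 * (s₁ * s₂)) := by
    rw [ha, div_pow, mul_pow 2, hσ2]
    field_simp
    norm_num
  have hb2 : b ^ 2 = (1 + e ^ 2) * (s₁ - s₂) ^ 2 / (4 * (s₁ * s₂)) := by
    rw [hb, div_pow, mul_pow 2, hσ2]
    field_simp
    norm_num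
  refine ⟨l₁ - s₁ * e, σ, a, ‖z‖, z.arg, hσ, ?_, ?_, ?_, fun θ hθ => ?_⟩
  · rw [ha]; positivity
  · rw [ha2, heδ]; ring
  · rw [hz2, ha2, hb2]
    field_simp
    ring
  have hcos : Real.cos (θ / 2) ≠ 0 :=
    (Real.cos_pos_of_mem_Ioo ⟨by linarith [hθ.1], by linarith [hθ.2]⟩).ne'
  have hrot : ‖z‖ * Real.cos (θ - z.arg) = b * Real.cos θ - e * Real.sin θ := by
    rw [Real.cos_sub, ← hzb]
    linear_combination Real.sin θ * hze
  have hsq := Real.sin_sq_add_cos_sq (θ / 2)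
  have hc : Real.cos θ = Real.cos (θ / 2) ^ 2 - Real.sin (θ / 2) ^ 2 := by
    rw [← Real.cos_two_mul', mul_div_cancel₀ _ (two_ne_zero' ℝ)]
  have hs : Real.sin θ = 2 * Real.sin (θ / 2) * Real.cos (θ / 2) := by
    rw [← Real.sin_two_mul, mul_div_cancel₀ _ (two_ne_zero' ℝ)]
  -- This makes both sides quadratic forms in the sine and cosine of `θ / 2`.
  have ha' : a = a * (Real.sin (θ / 2) ^ 2 + Real.cos (θ / 2) ^ 2) := by rw [hsq, mul_one]
  rw [cauchyPDFReal_add_mul_tan l₁ hs₁ hσ _ hcos, cauchyPDFReal_add_mul_tan l₂ hs₂ hσ _ hcos,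
    hrot, hc, hs, ha', ha, hb]
  constructor
  · congr 2
    field_simp
    linear_combination 2 * Real.sin (θ / 2) ^ 2 * hσ2
  · rw [show l₁ - s₁ * e - l₂ = s₂ * e by linear_combination heδ]
    congr 2
    field_simp
    linear_combination 2 * Real.sin (θ / 2) ^ 2 * hσ2

lemma abs_mul_cos_lt {a d : ℝ} (ha : 0 < a) (had : a ^ 2 - d ^ 2 = 1) (θ : ℝ) :
    |d * Real.cos θ| < a := by
  rw [abs_mul]
  have : |d| < a := abs_lt_of_sq_lt_sq (by linarith) ha.le
  nlinarith [Real.abs_cos_le_one θ, abs_nonneg d, abs_nonneg (Real.cos θ)]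

/-- The Bhattacharyya coefficients of two Cauchy laws as integrals over a circle. -/
lemma exists_bhattacharyyaCoeff_cauchy_eq (l₁ l₂ : ℝ) {s₁ s₂ : ℝ≥0} (hs₁ : 0 < s₁)
    (hs₂ : 0 < s₂) :
    ∃ a d : ℝ, 0 < a ∧
      a ^ 2 = (((s₁ : ℝ) + s₂) ^ 2 + (l₁ - l₂) ^ 2) / (4 * (s₁ * s₂)) ∧ a ^ 2 - d ^ 2 = 1 ∧
      ∀ α : ℝ, bhattacharyyaCoeff volume (cauchyPDFReal l₁ s₁) (cauchyPDFReal l₂ s₂) α =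
        (2 * π)⁻¹ * ∫ θ in (-π)..π,
          (a + d * Real.cos θ)⁻¹ ^ α * (a - d * Real.cos θ)⁻¹ ^ (1 - α) := by
  obtain ⟨c, σ, a, d, φ, hσ, ha, ha2, had, h⟩ := exists_cauchyPDFReal_midpoint l₁ l₂ hs₁ hs₂
  refine ⟨a, d, ha, ha2, had, fun α => ?_⟩
  have hM : ∀ x, 0 < cauchyPDFReal c σ x := cauchyPDF_pos c hσ.ne'
  have hp := cauchyPDF_pos l₁ hs₁.ne'
  have hq := cauchyPDF_pos l₂ hs₂.ne'
  -- The exponents sum to `1`, so exactly one factor of the midpoint density comes out.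
  have hsplit : ∀ x, cauchyPDFReal l₁ s₁ x ^ α * cauchyPDFReal l₂ s₂ x ^ (1 - α) =
      cauchyPDFReal c σ x * ((cauchyPDFReal l₁ s₁ x / cauchyPDFReal c σ x) ^ α *
        (cauchyPDFReal l₂ s₂ x / cauchyPDFReal c σ x) ^ (1 - α)) := by
    intro x
    have h1 : cauchyPDFReal c σ x ^ α * cauchyPDFReal c σ x ^ (1 - α) = cauchyPDFReal c σ x := by
      rw [← Real.rpow_add (hM x), add_sub_cancel, Real.rpow_one]
    have h2 := Real.rpow_pos_of_pos (hM x) α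
    have h3 := Real.rpow_pos_of_pos (hM x) (1 - α)
    rw [Real.div_rpow (hp x).le (hM x).le, Real.div_rpow (hq x).le (hM x).le]
    nth_rewrite 1 [← h1]
    field_simp
  let g : ℝ → ℝ := fun θ => (a + d * Real.cos θ)⁻¹ ^ α * (a - d * Real.cos θ)⁻¹ ^ (1 - α)
  have hg : Function.Periodic g (2 * π) := fun θ => by simp only [g, Real.cos_add_two_pi]
  unfold bhattacharyyaCoeff
  simp_rw [hsplit]
  rw [integral_cauchyPDFReal_mul c hσ]
  congr 1
  -- The phase `φ` disappears because `g` is integrated over a full period.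
  trans ∫ θ in (-π)..π, g (θ - φ)
  · rw [intervalIntegral.integral_of_le (by linarith [Real.pi_pos]), integral_Ioc_eq_integral_Ioo,
      intervalIntegral.integral_of_le (by linarith [Real.pi_pos]), integral_Ioc_eq_integral_Ioo]
    refine setIntegral_congr_fun measurableSet_Ioo fun θ hθ => ?_
    simp only [g]
    rw [(h θ hθ).1, (h θ hθ).2, mul_div_cancel_left₀ _ (hM _).ne',
      mul_div_cancel_left₀ _ (hM _).ne']
  · rw [intervalIntegral.integral_comp_sub_right]
    have := hg.intervalIntegral_add_eq (-π - φ) (-π)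
    rwa [show -π - φ + 2 * π = π - φ by ring, show -π + 2 * π = π by ring] at this

/-- The half-turn `θ ↦ θ - π` changes the sign of `cos θ` and so swaps the two factors. -/
lemma bhattacharyyaCoeff_cauchy_one_sub (l₁ l₂ : ℝ) {s₁ s₂ : ℝ≥0} (hs₁ : 0 < s₁) (hs₂ : 0 < s₂)
    (α : ℝ) :
    bhattacharyyaCoeff volume (cauchyPDFReal l₁ s₁) (cauchyPDFReal l₂ s₂) (1 - α) =
      bhattacharyyaCoeff volume (cauchyPDFReal l₁ s₁) (cauchyPDFReal l₂ s₂) α := by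
  obtain ⟨a, d, -, -, -, h⟩ := exists_bhattacharyyaCoeff_cauchy_eq l₁ l₂ hs₁ hs₂
  let g : ℝ → ℝ := fun θ => (a + d * Real.cos θ)⁻¹ ^ α * (a - d * Real.cos θ)⁻¹ ^ (1 - α)
  have hg : Function.Periodic g (2 * π) := fun θ => by simp only [g, Real.cos_add_two_pi]
  rw [h, h]
  congr 1
  trans ∫ θ in (-π)..π, g (θ - π)
  · refine intervalIntegral.integral_congr fun θ _ => ?_
    simp only [g, Real.cos_sub_pi, sub_sub_cancel, mul_neg, sub_neg_eq_add, ← sub_eq_add_neg]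
    exact mul_comm _ _
  · rw [intervalIntegral.integral_comp_sub_right]
    have := hg.intervalIntegral_add_eq (-π - π) (-π)
    rwa [show -π - π + 2 * π = π - π by ring, show -π + 2 * π = π by ring] at this

/-! ### The elliptic integral at `α = 1 / 2`. -/

lemma continuous_one_div_sqrt_one_sub_mul_sin_sq {m : ℝ} (hm : m ∈ Ico (0 : ℝ) 1) :
    Continuous fun u : ℝ => 1 / √(1 - m * Real.sin u ^ 2) := by
  refine Continuous.div (by fun_prop) (by fun_prop) fun u => (Real.sqrt_pos.2 ?_).ne'
  nlinarith [hm.1, hm.2, Real.sin_sq_le_one u, sq_nonneg (Real.sin u)]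

/-- A shift by `π / 2` turns cosine into sine; `π`-periodicity and evenness then give four equal
quarters. -/
lemma integral_one_div_sqrt_one_sub_mul_cos_sq {m : ℝ} (hm : m ∈ Ico (0 : ℝ) 1) :
    ∫ θ in (-π)..π, 1 / √(1 - m * Real.cos θ ^ 2) = 4 * completeEllipticK m := by
  let k : ℝ → ℝ := fun u => 1 / √(1 - m * Real.sin u ^ 2)
  have hk : Continuous k := continuous_one_div_sqrt_one_sub_mul_sin_sq hm
  have hper : Function.Periodic k π := fun u => by simp only [k, Real.sin_add_pi, neg_sq]
  have heven : ∫ u in (-(π / 2))..0, k u = ∫ u in 0..(π / 2), k u := by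
    have := intervalIntegral.integral_comp_neg (f := k) (a := 0) (b := π / 2)
    rw [neg_zero] at this
    rw [← this]
    simp only [k, Real.sin_neg, neg_sq]
  have h0 : ∫ u in (-(π / 2))..(π / 2), k u = 2 * completeEllipticK m := by
    rw [← intervalIntegral.integral_add_adjacent_intervals (hk.intervalIntegrable _ 0)
      (hk.intervalIntegrable 0 _), heven, two_mul]
    rfl
  have h1 : ∫ u in (π / 2)..(3 * π / 2), k u = ∫ u in (-(π / 2))..(π / 2), k u := by
    have := hper.intervalIntegral_add_eq (π / 2) (-(π / 2))
    rwa [show π / 2 + π = 3 * π / 2 by ring, show -(π / 2) + π = π / 2 by ring] at this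
  have h2 : ∫ θ in (-π)..π, 1 / √(1 - m * Real.cos θ ^ 2)
      = ∫ u in (-(π / 2))..(3 * π / 2), k u := by
    rw [show -(π / 2) = -π + π / 2 by ring, show 3 * π / 2 = π + π / 2 by ring,
      ← intervalIntegral.integral_comp_add_right]
    simp only [k, Real.sin_add_pi_div_two]
  rw [h2, ← intervalIntegral.integral_add_adjacent_intervals (hk.intervalIntegrable _ (π / 2))
      (hk.intervalIntegrable (π / 2) _), h1, h0]
  ring

lemma bhattacharyyaCoeff_cauchy_half (l₁ l₂ : ℝ) {s₁ s₂ : ℝ≥0} (hs₁ : 0 < s₁) (hs₂ : 0 < s₂)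
    {m : ℝ} (hm : m ∈ Ico (0 : ℝ) 1)
    (hmeq : m = (((s₁ : ℝ) - s₂) ^ 2 + (l₁ - l₂) ^ 2) / (((s₁ : ℝ) + s₂) ^ 2 + (l₁ - l₂) ^ 2)) :
    bhattacharyyaCoeff volume (cauchyPDFReal l₁ s₁) (cauchyPDFReal l₂ s₂) (1 / 2) =
      4 * √((s₁ : ℝ) * s₂) / (π * √(((s₁ : ℝ) + s₂) ^ 2 + (l₁ - l₂) ^ 2)) *
        completeEllipticK m := by
  have h₁ : (0 : ℝ) < s₁ := hs₁
  have h₂ : (0 : ℝ) < s₂ := hs₂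
  obtain ⟨a, d, ha, ha2, had, h⟩ := exists_bhattacharyyaCoeff_cauchy_eq l₁ l₂ hs₁ hs₂
  have hd : d ^ 2 = a ^ 2 * m := by
    rw [← sub_eq_iff_eq_add'.2 (sub_eq_iff_eq_add.1 had), ha2, hmeq]
    field_simp
    ring
  have hpt : ∀ θ : ℝ, (a + d * Real.cos θ)⁻¹ ^ (1 / 2 : ℝ) *
      (a - d * Real.cos θ)⁻¹ ^ (1 - 1 / 2 : ℝ) = a⁻¹ * (1 / √(1 - m * Real.cos θ ^ 2)) := by
    intro θ
    obtain ⟨hl, hr⟩ := abs_lt.1 (abs_mul_cos_lt ha had θ)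
    rw [sub_half, ← Real.mul_rpow (by rw [inv_nonneg]; linarith) (by rw [inv_nonneg]; linarith),
      ← Real.sqrt_eq_rpow, ← mul_inv,
      show (a + d * Real.cos θ) * (a - d * Real.cos θ) = a ^ 2 * (1 - m * Real.cos θ ^ 2) by
        linear_combination -Real.cos θ ^ 2 * hd,
      Real.sqrt_inv, Real.sqrt_mul (sq_nonneg a), Real.sqrt_sq ha.le, mul_inv, one_div]
  have ha' : a = √(((s₁ : ℝ) + s₂) ^ 2 + (l₁ - l₂) ^ 2) / (2 * √((s₁ : ℝ) * s₂)) := by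
    rw [← Real.sqrt_sq ha.le, ha2, Real.sqrt_div (by positivity), Real.sqrt_mul (by norm_num),
      show (4 : ℝ) = 2 ^ 2 by norm_num, Real.sqrt_sq (by norm_num)]
  rw [h]
  simp_rw [hpt]
  rw [intervalIntegral.integral_const_mul, integral_one_div_sqrt_one_sub_mul_cos_sq hm, ha']
  have := Real.sqrt_pos.2 (mul_pos h₁ h₂)
  have : 0 < √(((s₁ : ℝ) + s₂) ^ 2 + (l₁ - l₂) ^ 2) := Real.sqrt_pos.2 (by positivity)
  field_simp

/-! ### Minimality of `ρ_{1/2}` for general positive densities. -/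

/-- Weighted AM-GM supplies the integrable bound `α p + (1 - α) q`. -/
lemma integrable_rpow_mul_rpow {X : Type*} [MeasurableSpace X] {μ : Measure X} {p q : X → ℝ}
    (hp : Integrable p μ) (hq : Integrable q μ) (hp0 : ∀ x, 0 ≤ p x) (hq0 : ∀ x, 0 ≤ q x) {α : ℝ}
    (hα : α ∈ Icc (0 : ℝ) 1) : Integrable (fun x => p x ^ α * q x ^ (1 - α)) μ := by
  refine ((hp.const_mul α).add (hq.const_mul (1 - α))).mono'
    ((hp.aemeasurable.pow_const α).mul (hq.aemeasurable.pow_const (1 - α))).aestronglyMeasurable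
    (ae_of_all _ fun x => ?_)
  rw [Real.norm_of_nonneg (mul_nonneg (Real.rpow_nonneg (hp0 x) _) (Real.rpow_nonneg (hq0 x) _))]
  exact Real.geom_mean_le_arith_mean2_weighted hα.1 (sub_nonneg.2 hα.2) (hp0 x) (hq0 x)
    (add_sub_cancel _ _)

lemma bhattacharyyaCoeff_pos {X : Type*} [MeasurableSpace X] {μ : Measure X} [NeZero μ]
    {p q : X → ℝ} (hp : Integrable p μ) (hq : Integrable q μ) (hp0 : ∀ x, 0 < p x)
    (hq0 : ∀ x, 0 < q x) {α : ℝ} (hα : α ∈ Icc (0 : ℝ) 1) : 0 < bhattacharyyaCoeff μ p q α := by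
  have hpos : ∀ x, 0 < p x ^ α * q x ^ (1 - α) := fun x =>
    mul_pos (Real.rpow_pos_of_pos (hp0 x) _) (Real.rpow_pos_of_pos (hq0 x) _)
  refine (integral_pos_iff_support_of_nonneg (fun x => (hpos x).le)
    (integrable_rpow_mul_rpow hp hq (fun x => (hp0 x).le) (fun x => (hq0 x).le) hα)).2 ?_
  rw [Function.support_eq_univ fun x => (hpos x).ne']
  exact Measure.measure_univ_pos.2 (NeZero.ne μ)

/-- The defect in the arithmetic-geometric mean inequality for `p ^ α * q ^ (1 - α)` and
`p ^ (1 - α) * q ^ α`. -/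
lemma rpow_mul_rpow_add_sub_eq_sq {p q : ℝ} (hp : 0 < p) (hq : 0 < q) (α : ℝ) :
    p ^ α * q ^ (1 - α) + p ^ (1 - α) * q ^ (1 - (1 - α)) -
        2 * (p ^ (1 / 2 : ℝ) * q ^ (1 - 1 / 2 : ℝ)) =
      (p ^ (α / 2) * q ^ ((1 - α) / 2) - p ^ ((1 - α) / 2) * q ^ (α / 2)) ^ 2 := by
  have key : ∀ {x : ℝ}, 0 < x → ∀ r : ℝ, (x ^ (r / 2)) ^ 2 = x ^ r := fun hx r => by
    rw [sq, ← Real.rpow_add hx, add_halves]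
  have half : ∀ {x : ℝ}, 0 < x → x ^ (α / 2) * x ^ ((1 - α) / 2) = x ^ (1 / 2 : ℝ) := fun hx => by
    rw [← Real.rpow_add hx]; congr 1; ring
  rw [sub_half, sub_sub_cancel, ← half hp, ← half hq, ← key hp α, ← key hp (1 - α), ← key hq α,
    ← key hq (1 - α)]
  ring

/-- Taking logarithms gives `(α - 1 / 2) (log p - log q) = 0`. -/
lemma eq_of_rpow_mul_rpow_eq {p q : ℝ} (hp : 0 < p) (hq : 0 < q) {α : ℝ} (hα : α ≠ 1 / 2)
    (h : p ^ (α / 2) * q ^ ((1 - α) / 2) = p ^ ((1 - α) / 2) * q ^ (α / 2)) : p = q := by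
  have h' := congrArg Real.log h
  rw [Real.log_mul (Real.rpow_pos_of_pos hp _).ne' (Real.rpow_pos_of_pos hq _).ne',
    Real.log_mul (Real.rpow_pos_of_pos hp _).ne' (Real.rpow_pos_of_pos hq _).ne',
    Real.log_rpow hp, Real.log_rpow hq, Real.log_rpow hp, Real.log_rpow hq] at h'
  have h0 : (α - 1 / 2) * (Real.log p - Real.log q) = 0 := by linear_combination h'
  exact Real.log_injOn_pos hp hq
    (sub_eq_zero.1 ((mul_eq_zero.1 h0).resolve_left (sub_ne_zero.2 hα)))

section Symmetric

variable {X : Type*} [MeasurableSpace X] {μ : Measure X} {p q : X → ℝ} {α : ℝ}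

lemma integral_sq_eq_bhattacharyyaCoeff_sub (hp : Integrable p μ)
    (hq : Integrable q μ) (hp0 : ∀ x, 0 < p x) (hq0 : ∀ x, 0 < q x) (hα : α ∈ Icc (0 : ℝ) 1)
    (hsymm : bhattacharyyaCoeff μ p q (1 - α) = bhattacharyyaCoeff μ p q α) :
    Integrable (fun x => (p x ^ (α / 2) * q x ^ ((1 - α) / 2) -
      p x ^ ((1 - α) / 2) * q x ^ (α / 2)) ^ 2) μ ∧
    ∫ x, (p x ^ (α / 2) * q x ^ ((1 - α) / 2) - p x ^ ((1 - α) / 2) * q x ^ (α / 2)) ^ 2 ∂μ =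
      2 * (bhattacharyyaCoeff μ p q α - bhattacharyyaCoeff μ p q (1 / 2)) := by
  have hint := fun {β : ℝ} (hβ : β ∈ Icc (0 : ℝ) 1) =>
    integrable_rpow_mul_rpow hp hq (fun x => (hp0 x).le) (fun x => (hq0 x).le) hβ
  have h1 := hint hα
  have h2 := hint (β := 1 - α) ⟨by linarith [hα.2], by linarith [hα.1]⟩
  have h3 := hint (β := 1 / 2) ⟨by norm_num, by norm_num⟩
  simp_rw [← fun x => rpow_mul_rpow_add_sub_eq_sq (hp0 x) (hq0 x) α]
  refine ⟨(h1.add h2).sub (h3.const_mul 2), ?_⟩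
  rw [integral_sub (by exact h1.add h2) (h3.const_mul 2), integral_add h1 h2,
    integral_const_mul]
  unfold bhattacharyyaCoeff at hsymm ⊢
  rw [hsymm]
  ring

lemma bhattacharyyaCoeff_half_le (hp : Integrable p μ)
    (hq : Integrable q μ) (hp0 : ∀ x, 0 < p x) (hq0 : ∀ x, 0 < q x) (hα : α ∈ Icc (0 : ℝ) 1)
    (hsymm : bhattacharyyaCoeff μ p q (1 - α) = bhattacharyyaCoeff μ p q α) :
    bhattacharyyaCoeff μ p q (1 / 2) ≤ bhattacharyyaCoeff μ p q α := by
  have h := (integral_sq_eq_bhattacharyyaCoeff_sub hp hq hp0 hq0 hα hsymm).2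
  have h0 : 0 ≤ ∫ x, (p x ^ (α / 2) * q x ^ ((1 - α) / 2) -
      p x ^ ((1 - α) / 2) * q x ^ (α / 2)) ^ 2 ∂μ := integral_nonneg fun x => sq_nonneg _
  linarith

lemma ae_eq_of_bhattacharyyaCoeff_eq_half (hp : Integrable p μ)
    (hq : Integrable q μ) (hp0 : ∀ x, 0 < p x) (hq0 : ∀ x, 0 < q x) (hα : α ∈ Icc (0 : ℝ) 1)
    (hsymm : bhattacharyyaCoeff μ p q (1 - α) = bhattacharyyaCoeff μ p q α) (hne : α ≠ 1 / 2)
    (heq : bhattacharyyaCoeff μ p q α = bhattacharyyaCoeff μ p q (1 / 2)) : p =ᵐ[μ] q := by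
  obtain ⟨hint, h⟩ := integral_sq_eq_bhattacharyyaCoeff_sub hp hq hp0 hq0 hα hsymm
  rw [heq, sub_self, mul_zero, integral_eq_zero_iff_of_nonneg (fun x => by positivity) hint] at h
  filter_upwards [h] with x hx
  exact eq_of_rpow_mul_rpow_eq (hp0 x) (hq0 x) hne
    (sub_eq_zero.1 (pow_eq_zero_iff two_ne_zero |>.1 hx))

end Symmetric

/-! ### Equality of laws, and the conclusion. -/

lemma cauchyMeasure_eq_iff_ae_eq (l₁ l₂ : ℝ) {s₁ s₂ : ℝ≥0} (hs₁ : 0 < s₁) (hs₂ : 0 < s₂) :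
    cauchyMeasure l₁ s₁ = cauchyMeasure l₂ s₂ ↔
      cauchyPDFReal l₁ s₁ =ᵐ[volume] cauchyPDFReal l₂ s₂ := by
  rw [cauchyMeasure_of_scale_ne_zero l₁ hs₁.ne', cauchyMeasure_of_scale_ne_zero l₂ hs₂.ne',
    withDensity_eq_iff (by fun_prop) (by fun_prop) (by simp [hs₁.ne'])]
  refine Filter.eventually_congr (ae_of_all _ fun x => ?_)
  exact ENNReal.ofReal_eq_ofReal_iff (cauchyPDF_pos l₁ hs₁.ne' x).le
    (cauchyPDF_pos l₂ hs₂.ne' x).le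

lemma bhattacharyyaCoeff_of_ae_eq {X : Type*} [MeasurableSpace X] {μ : Measure X} {p q : X → ℝ}
    (hp0 : ∀ x, 0 < p x) (h : p =ᵐ[μ] q) (α : ℝ) : bhattacharyyaCoeff μ p q α = ∫ x, p x ∂μ := by
  refine integral_congr_ae ?_
  filter_upwards [h] with x hx
  rw [← hx, ← Real.rpow_add (hp0 x), add_sub_cancel, Real.rpow_one]

theorem mainTheorem11 (l₁ l₂ : ℝ) (s₁ s₂ : ℝ≥0) (hs₁ : 0 < s₁) (hs₂ : 0 < s₂) :
    let p : ℝ → ℝ := cauchyPDFReal l₁ s₁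
    let q : ℝ → ℝ := cauchyPDFReal l₂ s₂
    let ρ : ℝ → ℝ := bhattacharyyaCoeff volume p q
    let DB : ℝ → ℝ := bhattacharyyaDist volume p q
    let DC : ℝ := chernoffInformation volume p q
    let δ : ℝ := l₁ - l₂
    let m : ℝ := (((s₁ : ℝ) - s₂) ^ 2 + δ ^ 2) / (((s₁ : ℝ) + s₂) ^ 2 + δ ^ 2)
    -- the coefficients are well defined, finite and positive
    (∀ α ∈ Icc (0 : ℝ) 1,
      Integrable (fun x : ℝ => p x ^ α * q x ^ (1 - α)) volume ∧ 0 < ρ α) ∧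
    -- symmetry
    (∀ α ∈ Icc (0 : ℝ) 1, ρ α = ρ (1 - α) ∧ DB α = DB (1 - α)) ∧
    -- distinct laws: `1 / 2` is the one and only maximiser
    (cauchyMeasure l₁ s₁ ≠ cauchyMeasure l₂ s₂ →
      ∀ α ∈ Icc (0 : ℝ) 1, (IsMaxOn DB (Icc 0 1) α ↔ α = 1 / 2)) ∧
    -- equal laws: the distance vanishes identically and every `α` is a maximiser
    (cauchyMeasure l₁ s₁ = cauchyMeasure l₂ s₂ →
      ∀ α ∈ Icc (0 : ℝ) 1, DB α = 0 ∧ IsMaxOn DB (Icc 0 1) α) ∧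
    -- the Chernoff information is a maximum, attained at `1 / 2`
    IsGreatest (DB '' Icc 0 1) DC ∧
    DC = DB (1 / 2) ∧
    DC = -Real.log (ρ (1 / 2)) ∧
    -- closed form
    ρ (1 / 2) = ∫ x : ℝ, √(p x * q x) ∧
    m ∈ Ico (0 : ℝ) 1 ∧
    ρ (1 / 2) =
      4 * √((s₁ : ℝ) * s₂) / (π * √(((s₁ : ℝ) + s₂) ^ 2 + δ ^ 2)) * completeEllipticK m := by
  intro p q ρ DB DC δ m
  have h₁ : (0 : ℝ) < s₁ := hs₁
  have h₂ : (0 : ℝ) < s₂ := hs₂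
  have hp : Integrable p volume := integrable_cauchyPDFReal l₁
  have hq : Integrable q volume := integrable_cauchyPDFReal l₂
  have hp0 : ∀ x, 0 < p x := cauchyPDF_pos l₁ hs₁.ne'
  have hq0 : ∀ x, 0 < q x := cauchyPDF_pos l₂ hs₂.ne'
  have hpos : ∀ α ∈ Icc (0 : ℝ) 1, 0 < ρ α := fun α hα => bhattacharyyaCoeff_pos hp hq hp0 hq0 hα
  have hsymm : ∀ α, ρ (1 - α) = ρ α := bhattacharyyaCoeff_cauchy_one_sub l₁ l₂ hs₁ hs₂
  have hhalf : (1 / 2 : ℝ) ∈ Icc (0 : ℝ) 1 := ⟨by norm_num, by norm_num⟩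
  have hmax : IsMaxOn DB (Icc 0 1) (1 / 2) := isMaxOn_iff.2 fun α hα =>
    neg_le_neg (Real.log_le_log (hpos _ hhalf)
      (bhattacharyyaCoeff_half_le hp hq hp0 hq0 hα (hsymm α)))
  have hgreatest : IsGreatest (DB '' Icc 0 1) (DB (1 / 2)) :=
    ⟨mem_image_of_mem _ hhalf, forall_mem_image.2 fun α hα => isMaxOn_iff.1 hmax α hα⟩
  have hDC : DC = DB (1 / 2) := hgreatest.csSup_eq
  have hm : m ∈ Ico (0 : ℝ) 1 := by
    refine ⟨by positivity, (div_lt_one (by positivity)).2 ?_⟩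
    nlinarith [mul_pos h₁ h₂]
  refine ⟨fun α hα => ⟨integrable_rpow_mul_rpow hp hq (fun x => (hp0 x).le) (fun x => (hq0 x).le)
    hα, hpos α hα⟩, fun α _ => ⟨(hsymm α).symm, congrArg (fun r => -Real.log r) (hsymm α).symm⟩,
    fun hne α hα => ⟨fun hα' => ?_, fun h => h ▸ hmax⟩, fun heq => ?_, hDC ▸ hgreatest, hDC, hDC,
    ?_, hm, bhattacharyyaCoeff_cauchy_half l₁ l₂ hs₁ hs₂ hm rfl⟩
  · by_contra hα2
    -- Two maximisers share the same value, so `ρ α = ρ (1 / 2)`, the equality case.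
    have hlog : Real.log (ρ α) = Real.log (ρ (1 / 2)) :=
      neg_injective (le_antisymm (isMaxOn_iff.1 hmax α hα) (isMaxOn_iff.1 hα' _ hhalf))
    exact hne ((cauchyMeasure_eq_iff_ae_eq l₁ l₂ hs₁ hs₂).2
      (ae_eq_of_bhattacharyyaCoeff_eq_half hp hq hp0 hq0 hα (hsymm α) hα2
        (Real.log_injOn_pos (hpos α hα) (hpos _ hhalf) hlog)))
  · have hzero : ∀ α, DB α = 0 := fun α => by
      have h : ρ α = 1 := (bhattacharyyaCoeff_of_ae_eq hp0
        ((cauchyMeasure_eq_iff_ae_eq l₁ l₂ hs₁ hs₂).1 heq) α).trans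
        (integral_cauchyPDFReal_eq_one l₁ hs₁.ne')
      change -Real.log (ρ α) = 0
      rw [h, Real.log_one, neg_zero]
    exact fun α _ => ⟨hzero α, isMaxOn_iff.2 fun β _ => (hzero β).trans_le (hzero α).ge⟩
  · refine integral_congr_ae (ae_of_all _ fun x => ?_)
    simp only [sub_half]
    rw [← Real.mul_rpow (hp0 x).le (hq0 x).le, ← Real.sqrt_eq_rpow]
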